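/- Let $K\ge 0$ be an integer and, for $k=1,\dots,K$, let $(\mathcal X_k,d_k)$ be a metric space that is a Radon space, i.e. $\mathcal X_k$ is separable and every Borel probability measure $\mu$ on $\mathcal X_k$ satisfies $\mu(B)=\sup\{\mu(C): C\subseteq B,\ C\text{ compact}\}$ for all Borel sets $B$. Let $\mathcal X=\mathcal X_1\times\dots\times\mathcal X_K$, let $L_1,\dots,L_K\ge 0$, and put $d_L(x,x')=\sum_{k=1}^K L_k\,d_k(x^k,x'^k)$. A real function $g$ on a set $D\subseteq\mathcal X$ is called $d_L$-short if $|g(x)-g(x')|\le d_L(x,x')$ for all $x,x'\in D$. Let $G\colon\mathcal X\to\mathbb R$ be $d_L$-short, let $\mathcal O\subseteq\mathcal X$ be any set, and let $m,\theta\in\mathbb R$. For $x_0,x_1\in\mathcal X$ and $\varepsilon\in\{0,1\}^K$ let $x_\varepsilon\in\mathcal X$ be the point whose $k$-th component is $x_{\varepsilon_k}^k$, and let $\mathcal C(x_0,x_1)=\{x_\varepsilon:\varepsilon\in\{0,1\}^K\}$. Let - $\mathcal A$ be the set of pairs $(g,\mu)$ such that $g\colon\mathcal X\to\mathbb R$ is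 $d_L$-short, $\mu=\mu_1\otimes\dots\otimes\mu_K$ with Borel probability measures $\mu_k$ on $\mathcal X_k$, $g=G$ on $\mathcal O$, $g$ is $\mu$-integrable, and $\mathbb E_\mu[g]\ge m$; - $\mathcal A_\Delta$ be the set of pairs $(g,\mu)$ such that, for some $x_0,x_1\in\mathcal X$, $g\colon\mathcal C(x_0,x_1)\cup\mathcal O\to\mathbb R$ is $d_L$-short, $\mu=\mu_1\otimes\dots\otimes\mu_K$ is a product of Borel probability measures with $\mu(\mathcal C(x_0,x_1))=1$, $g=G$ on $\mathcal O$, and $\mathbb E_\mu[g]\ge m$. **Theorem.** 1. The extreme values agree: $$\sup_{(g,\mu)\in\mathcal A}\mu[g\le\theta]=\sup_{(g,\mu)\in\mathcal A_\Delta}\mu[g\le\theta],\qquad \inf_{(g,\mu)\in\mathcal A}\mu[g\le\theta]=\inf_{(g,\mu)\in\mathcal A_\Delta}\mu[g\le\theta],$$ where suprema and infima are taken in $[0,\infty]$. 2. $\mathcal A_\Delta$ is described by parameters in $\mathcal Q=\mathcal X\times\mathcal X\times[0,1]^K\times\mathbb R^{\{0,1\}^K}$. Namely, let $\mathcal F\subseteq\mathcal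 Q$ be the set of all $(x_0,x_1,p,y)$ such that $|y_\varepsilon-y_{\varepsilon'}|\le d_L(x_\varepsilon,x_{\varepsilon'})$ for all $\varepsilon,\varepsilon'$, $|y_\varepsilon-G(z)|\le d_L(x_\varepsilon,z)$ for all $\varepsilon$ and all $z\in\mathcal O$, and $\sum_{\varepsilon}\big(\prod_k p_k^{1-\varepsilon_k}(1-p_k)^{\varepsilon_k}\big)y_\varepsilon\ge m$. If $(g,\mu)$ belongs to $\mathcal A_\Delta$ with points $x_0,x_1$, then there is $p\in[0,1]^K$ such that $\mu=\bigotimes_{k}\big(p_k\delta_{x_0^k}+(1-p_k)\delta_{x_1^k}\big)$ and $(x_0,x_1,p,(g(x_\varepsilon))_\varepsilon)\in\mathcal F$. Conversely, if $(x_0,x_1,p,y)\in\mathcal F$, then there is exactly one $g\colon\mathcal C(x_0,x_1)\cup\mathcal O\to\mathbb R$ such that $g(x_\varepsilon)=y_\varepsilon$ for all $\varepsilon$ and $\big(g,\bigotimes_{k}(p_k\delta_{x_0^k}+(1-p_k)\delta_{x_1^k})\big)$ belongs to $\mathcal A_\Delta$ with points $x_0,x_1$. 3. The reduced problem has dimension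 $2\sum_{k}\dim(\mathcal X_k)+2^K+K$, in the following sense. Let $\dim$ be the Hausdorff dimension, finite products carrying the maximum metric. Suppose that each $\mathcal X_k$ is non-empty and that there is an integer $n_k\ge 0$ such that every point of $\mathcal X_k$ has arbitrarily small neighbourhoods that are bi-Lipschitz equivalent to a subset of $\mathbb R^{n_k}$ with non-empty interior (for example, $\mathcal X_k=\mathbb R$ or an interval $[a_k,b_k]$ with $a_k<b_k$, where $n_k=1$). Then $$\dim(\mathcal Q)=2\sum_{k=1}^K\dim(\mathcal X_k)+2^K+K,$$ and the set $\mathcal F$ of feasible parameters has this same dimension whenever it has non-empty interior in $\mathcal Q$. -/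

import Mathlib

open MeasureTheory Set Topology
open scoped ENNReal NNReal

noncomputable section

namespace LegacyUQ

/-- A Radon space: a separable topological space on which every Borel probability measure
is inner regular with respect to compact sets. -/
def IsRadonSpace (Z : Type*) [TopologicalSpace Z] [MeasurableSpace Z] [BorelSpace Z] : Prop :=
  TopologicalSpace.SeparableSpace Z ∧
    ∀ μ : Measure Z, IsProbabilityMeasure μ → ∀ B : Set Z, MeasurableSet B →
      μ B = ⨆ (C : Set Z) (_ : C ⊆ B) (_ : IsCompact C), μ C

section Shortness

variable {K : ℕ} {X : Fin K → Type*} [∀ k, MetricSpace (X k)]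

/-- The quasi-metric `d_L(x, x') = ∑ₖ Lₖ dₖ(xᵏ, x'ᵏ)`. -/
def dL (L : Fin K → ℝ) (x x' : ∀ k, X k) : ℝ := ∑ k, L k * dist (x k) (x' k)

/-- A real function on a subset `D` of the product space is `d_L`-short. -/
def IsShortOn (L : Fin K → ℝ) (D : Set (∀ k, X k)) (g : D → ℝ) : Prop :=
  ∀ x x' : D, |g x - g x'| ≤ dL L (x : ∀ k, X k) (x' : ∀ k, X k)

/-- A real function on the whole product space is `d_L`-short. -/
def IsShort (L : Fin K → ℝ) (g : (∀ k, X k) → ℝ) : Prop :=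
  ∀ x x' : ∀ k, X k, |g x - g x'| ≤ dL L x x'

end Shortness

section Cube

variable {K : ℕ} {X : Fin K → Type*}

/-- The vertex `x_ε`: its `k`-th component is that of `x₀` if `εₖ = 0` (`false`) and that of `x₁`
if `εₖ = 1` (`true`). -/
def vertex (x₀ x₁ : ∀ k, X k) (ε : Fin K → Bool) : ∀ k, X k :=
  fun k => if ε k then x₁ k else x₀ k

/-- The discrete cube `C(x₀, x₁)`. -/
def cube (x₀ x₁ : ∀ k, X k) : Set (∀ k, X k) := range (vertex x₀ x₁)

/-- The vertex `x_ε` as a point of `C(x₀, x₁) ∪ O`. -/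
def cubePoint (O : Set (∀ k, X k)) (x₀ x₁ : ∀ k, X k) (ε : Fin K → Bool) :
    ↥(cube x₀ x₁ ∪ O) :=
  ⟨vertex x₀ x₁ ε, Or.inl ⟨ε, rfl⟩⟩

end Cube

section Admissible

variable {K : ℕ} {X : Fin K → Type*} [∀ k, MeasurableSpace (X k)]

/-- `μ = μ₁ ⊗ ⋯ ⊗ μ_K` for probability measures `μₖ` on the factors. -/
def IsProductProbability (μ : Measure (∀ k, X k)) : Prop :=
  ∃ ν : ∀ k, ProbabilityMeasure (X k), μ = Measure.pi fun k => (ν k : Measure (X k))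

/-- The product measure `⨂ₖ (pₖ δ_{x₀ᵏ} + (1 - pₖ) δ_{x₁ᵏ})`. -/
def twoPointProduct (x₀ x₁ : ∀ k, X k) (p : Fin K → unitInterval) : Measure (∀ k, X k) :=
  Measure.pi fun k =>
    ENNReal.ofReal (p k) • Measure.dirac (x₀ k) + ENNReal.ofReal (1 - p k) • Measure.dirac (x₁ k)

variable [∀ k, MetricSpace (X k)]

/-- The admissible set of the full problem. -/
def admissible (L : Fin K → ℝ) (G : (∀ k, X k) → ℝ) (O : Set (∀ k, X k)) (m : ℝ) :
    Set (((∀ k, X k) → ℝ) × Measure (∀ k, X k)) :=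
  {q | IsShort L q.1 ∧ IsProductProbability q.2 ∧ (∀ z ∈ O, q.1 z = G z) ∧
    Integrable q.1 q.2 ∧ m ≤ ∫ x, q.1 x ∂q.2}

/-- A reduced scenario over the observation set `O`: two points `x₀, x₁`, a function defined only
on `C(x₀, x₁) ∪ O`, and a measure on the product space. -/
abbrev ReducedScenario (O : Set (∀ k, X k)) :=
  Σ x : (∀ k, X k) × (∀ k, X k), (↥(cube x.1 x.2 ∪ O) → ℝ) × Measure (∀ k, X k)

/-- The admissible set of the reduced problem. The measure is a product probability measure carried
by the finite set `C(x₀, x₁)`, so the mean of `g` is the integral of any extension of `g`; the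
extension by zero is used. -/
def reducedAdmissible (L : Fin K → ℝ) (G : (∀ k, X k) → ℝ) (O : Set (∀ k, X k)) (m : ℝ) :
    Set (ReducedScenario O) :=
  {q | IsShortOn L (cube q.1.1 q.1.2 ∪ O) q.2.1 ∧
    IsProductProbability q.2.2 ∧ q.2.2 (cube q.1.1 q.1.2)ᶜ = 0 ∧
    (∀ (z : ∀ k, X k) (hz : z ∈ O), q.2.1 ⟨z, Or.inr hz⟩ = G z) ∧
    m ≤ ∫ x, Function.extend Subtype.val q.2.1 0 x ∂q.2.2}

/-- `μ[g ≤ θ]` for a function defined on the whole product space. -/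
def failureProb (θ : ℝ) (q : ((∀ k, X k) → ℝ) × Measure (∀ k, X k)) : ℝ≥0∞ :=
  q.2 {x | q.1 x ≤ θ}

/-- `μ[g ≤ θ]` for a reduced scenario: the measure of the set of points of `C(x₀, x₁) ∪ O` at which
`g` is at most `θ`. -/
def reducedFailureProb {O : Set (∀ k, X k)} (θ : ℝ) (q : ReducedScenario O) : ℝ≥0∞ :=
  q.2.2 (Subtype.val '' {x | q.2.1 x ≤ θ})

end Admissible

section Parameters

variable {K : ℕ}

/-- The unknowns `(x₀, x₁, p, y)` of the reduced problem, where `p ∈ [0,1]^K` and `y` lists a value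
`y_ε` for each `ε ∈ {0,1}^K`. -/
abbrev Parameters (X : Fin K → Type*) :=
  (∀ k, X k) × (∀ k, X k) × (Fin K → unitInterval) × ((Fin K → Bool) → ℝ)

/-- The weight `∏ₖ pₖ^(1 - εₖ) (1 - pₖ)^εₖ` of the vertex `x_ε`. -/
def weight (p : Fin K → unitInterval) (ε : Fin K → Bool) : ℝ :=
  ∏ k, if ε k then 1 - (p k : ℝ) else (p k : ℝ)

variable {X : Fin K → Type*} [∀ k, MetricSpace (X k)]

/-- The feasible parameters of the reduced problem. -/
def feasible (L : Fin K → ℝ) (G : (∀ k, X k) → ℝ) (O : Set (∀ k, X k)) (m : ℝ) :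
    Set (Parameters X) :=
  {(x₀, x₁, p, y) |
    (∀ ε ε', |y ε - y ε'| ≤ dL L (vertex x₀ x₁ ε) (vertex x₀ x₁ ε')) ∧
    (∀ ε, ∀ z ∈ O, |y ε - G z| ≤ dL L (vertex x₀ x₁ ε) z) ∧
    m ≤ ∑ ε, weight p ε * y ε}

end Parameters

/-- `Z` is a non-empty metric space that is locally described by `n` real parameters: every point
has arbitrarily small neighbourhoods that some bi-Lipschitz map identifies with a subset of `ℝⁿ`
with non-empty interior. Examples are `ℝⁿ`, intervals of positive length, convex bodies in `ℝⁿ`, and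
`n`-dimensional Riemannian manifolds with or without boundary. -/
def IsLocallyParametrized (Z : Type*) [MetricSpace Z] (n : ℕ) : Prop :=
  Nonempty Z ∧ ∀ z : Z, ∀ U ∈ 𝓝 z, ∃ V ∈ 𝓝 z, V ⊆ U ∧
    ∃ (φ : Z → Fin n → ℝ) (a b : ℝ≥0),
      LipschitzOnWith a φ V ∧ AntilipschitzWith b (V.domRestrict φ) ∧ (interior (φ '' V)).Nonempty

end LegacyUQ

end

open LegacyUQ

/-! With `g` fixed, the mean of `g` and the probability of `g ≤ θ` are both affine in each factor
`μₖ`. Integrating out the other coordinates leaves two functions `h`, `f` on one factor, coming from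
`g` and from plus or minus the indicator of `g ≤ θ`. The core is a planar fact
(`exists_two_point_ge`): some probability measure with at most two atoms lowers neither mean. If
not, after centring, a line `h + c f = 0` with `c ≥ 0` bounds the values of `(h, f)` from above.
Mean zero puts almost all values on that line, and the failure of two-point mixtures keeps them on
one side of `f = 0`, which contradicts mean zero.

Replacing the factors one at a time (`exists_forall_twoPoint`) and restricting `g` bounds the full
problem by the reduced one. Conversely, a McShane extension (`IsShortOn.exists_extension`) turns a
reduced scenario into a full one with the same mean and failure probability.

The parametrization follows by multiplying out the product of two-point measures
(`twoPointProduct_eq_sum`). The dimension follows from bi-Lipschitz local models, which are stable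
under products. -/

namespace LegacyUQ

/-! ### Hausdorff dimension through bi-Lipschitz local models -/

section Dimension

/-- Every point of `Z` has arbitrarily small neighbourhoods that some bi-Lipschitz map identifies
with a subset of `E` with non-empty interior. -/
def IsLocallyModelled (Z E : Type*) [PseudoEMetricSpace Z] [PseudoEMetricSpace E] : Prop :=
  ∀ z : Z, ∀ U ∈ 𝓝 z, ∃ V ∈ 𝓝 z, V ⊆ U ∧ ∃ (φ : Z → E) (a b : ℝ≥0),
    LipschitzOnWith a φ V ∧ (∀ x ∈ V, ∀ y ∈ V, edist x y ≤ b * edist (φ x) (φ y)) ∧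
      (interior (φ '' V)).Nonempty

theorem IsLocallyParametrized.isLocallyModelled {Z : Type*} [MetricSpace Z] {n : ℕ}
    (h : IsLocallyParametrized Z n) : IsLocallyModelled Z (Fin n → ℝ) := by
  intro z U hU
  obtain ⟨V, hV, hVU, φ, a, b, h1, h2, h3⟩ := h.2 z U hU
  exact ⟨V, hV, hVU, φ, a, b, h1, fun x hx y hy => h2 ⟨x, hx⟩ ⟨y, hy⟩, h3⟩

/-- Upper bound: countably many chart domains cover `Z`, and each inverse chart is Lipschitz. Lower
bound: a chart inside `S` has an image with interior, hence of full dimension, and Lipschitz maps do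
not raise dimension. -/
theorem IsLocallyModelled.dimH_eq {Z E : Type*} [MetricSpace Z]
    [SecondCountableTopology Z] [NormedAddCommGroup E] [NormedSpace ℝ E] [FiniteDimensional ℝ E]
    (h : IsLocallyModelled Z E) {S : Set Z} (hS : (interior S).Nonempty) :
    dimH S = Module.finrank ℝ E := by
  apply le_antisymm
  · choose V hV _ φ a b _ h2 _ using fun z => h z univ Filter.univ_mem
    obtain ⟨t, htc, ht⟩ := TopologicalSpace.countable_cover_nhds hV
    refine (dimH_mono (subset_univ S)).trans ?_
    rw [← ht, dimH_bUnion htc]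
    refine iSup₂_le fun z _ => ?_
    have hanti : AntilipschitzWith (b z) (fun x : V z => φ z x) :=
      fun x y => h2 z x x.2 y y.2
    calc dimH (V z) = dimH ((Subtype.val : V z → Z) '' univ) := by simp
      _ = dimH (univ : Set (V z)) := isometry_subtype_coe.dimH_image _
      _ ≤ dimH ((fun x : V z => φ z x) '' univ) := hanti.le_dimH_image _
      _ ≤ dimH (univ : Set E) := dimH_mono (subset_univ _)
      _ = _ := Real.dimH_univ_eq_finrank E
  · obtain ⟨z, hz⟩ := hS
    obtain ⟨V, _, hVU, φ, a, b, h1, _, h3⟩ := h z S (mem_interior_iff_mem_nhds.1 hz)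
    rw [← Real.dimH_of_nonempty_interior h3]
    exact h1.dimH_image_le.trans (dimH_mono hVU)

/-- Hausdorff dimension is not additive under products in general, so charts are multiplied instead.
For the maximum metric the constants of the factors combine by `max`. -/
theorem IsLocallyModelled.prod {Z W E F : Type*} [PseudoEMetricSpace Z] [PseudoEMetricSpace W]
    [PseudoEMetricSpace E] [PseudoEMetricSpace F] (hZ : IsLocallyModelled Z E)
    (hW : IsLocallyModelled W F) : IsLocallyModelled (Z × W) (E × F) := by
  rintro ⟨z, w⟩ U hU
  obtain ⟨U₁, hU₁, U₂, hU₂, hsub⟩ := mem_nhds_prod_iff.1 hU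
  obtain ⟨V, hV, hVU, φ, a, b, h1, h2, h3⟩ := hZ z U₁ hU₁
  obtain ⟨V', hV', hVU', φ', a', b', h1', h2', h3'⟩ := hW w U₂ hU₂
  refine ⟨V ×ˢ V', prod_mem_nhds hV hV', (prod_mono hVU hVU').trans hsub, Prod.map φ φ',
    max a a', max b b', ?_, ?_, ?_⟩
  · rintro ⟨x, x'⟩ ⟨hx, hx'⟩ ⟨y, y'⟩ ⟨hy, hy'⟩
    simp only [Prod.edist_eq, Prod.map]
    refine max_le ((h1 hx hy).trans ?_) ((h1' hx' hy').trans ?_)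
    · gcongr <;> simp
    · gcongr <;> simp
  · rintro ⟨x, x'⟩ ⟨hx, hx'⟩ ⟨y, y'⟩ ⟨hy, hy'⟩
    simp only [Prod.edist_eq, Prod.map]
    refine max_le ((h2 x hx y hy).trans ?_) ((h2' x' hx' y' hy').trans ?_)
    · gcongr <;> simp
    · gcongr <;> simp
  · rw [prodMap_image_prod, interior_prod_eq]
    exact h3.prod h3'

theorem IsLocallyModelled.pi {ι : Type*} [Fintype ι] {Z E : ι → Type*}
    [∀ i, PseudoEMetricSpace (Z i)] [∀ i, PseudoEMetricSpace (E i)]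
    (h : ∀ i, IsLocallyModelled (Z i) (E i)) : IsLocallyModelled (∀ i, Z i) (∀ i, E i) := by
  intro z U hU
  rw [nhds_pi, Filter.mem_pi'] at hU
  obtain ⟨I, T, hT, hsub⟩ := hU
  choose V hV hVU φ a b h1 h2 h3 using fun i => h i (z i) (T i) (hT i)
  refine ⟨univ.pi V, set_pi_mem_nhds finite_univ fun i _ => hV i,
    fun x hx => hsub fun i _ => hVU i (hx i (mem_univ i)), fun x i => φ i (x i),
    Finset.univ.sup a, Finset.univ.sup b, ?_, ?_, ?_⟩
  · intro x hx y hy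
    refine edist_pi_le_iff.2 fun i => (h1 i (hx i (mem_univ i)) (hy i (mem_univ i))).trans ?_
    gcongr
    · exact Finset.le_sup (Finset.mem_univ i)
    · exact edist_le_pi_edist x y i
  · intro x hx y hy
    refine edist_pi_le_iff.2 fun i =>
      (h2 i _ (hx i (mem_univ i)) _ (hy i (mem_univ i))).trans ?_
    gcongr
    · exact Finset.le_sup (Finset.mem_univ i)
    · exact edist_le_pi_edist (fun i => φ i (x i)) (fun i => φ i (y i)) i
  · choose e he using h3
    refine ⟨e, mem_interior_iff_mem_nhds.2 (Filter.mem_of_superset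
      (set_pi_mem_nhds finite_univ fun i _ => mem_interior_iff_mem_nhds.1 (he i)) ?_)⟩
    intro y hy
    choose x hx hxy using fun i => hy i (mem_univ i)
    exact ⟨x, fun i _ => hx i, funext hxy⟩

theorem isLocallyModelled_self (E : Type*) [PseudoEMetricSpace E] : IsLocallyModelled E E := by
  intro z U hU
  refine ⟨U, hU, subset_rfl, id, 1, 1, LipschitzWith.id.lipschitzOnWith, fun x _ y _ => by simp, ?_⟩
  rw [image_id]
  exact ⟨z, mem_interior_iff_mem_nhds.2 hU⟩

theorem isLocallyModelled_unitInterval : IsLocallyModelled unitInterval ℝ := by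
  intro z U hU
  refine ⟨U, hU, subset_rfl, Subtype.val, 1, 1, LipschitzWith.subtype_val _ |>.lipschitzOnWith,
    fun x _ y _ => by simp [Subtype.edist_eq], ?_⟩
  obtain ⟨T, hT, hTU⟩ := mem_nhds_subtype _ _ _ |>.1 hU
  obtain ⟨W, hWT, hWo, hzW⟩ := mem_nhds_iff.1 hT
  -- An endpoint is not interior to the image, but each of its neighbourhoods meets the open
  -- interval, which suffices.
  have hz : (z : ℝ) ∈ closure (Ioo (0 : ℝ) 1) := by
    rw [closure_Ioo zero_ne_one]; exact z.2
  obtain ⟨y, hy⟩ := mem_closure_iff.1 hz W hWo hzW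
  refine ⟨y, interior_maximal ?_ (hWo.inter isOpen_Ioo) hy⟩
  rintro x ⟨hxW, hx⟩
  exact ⟨⟨x, hx.1.le, hx.2.le⟩, hTU (hWT hxW), rfl⟩

theorem dimH_parameters {K : ℕ} {X : Fin K → Type*} [∀ k, MetricSpace (X k)]
    [∀ k, SecondCountableTopology (X k)] (hX : ∀ k, ∃ n : ℕ, IsLocallyParametrized (X k) n)
    {S : Set (Parameters X)} (hS : (interior S).Nonempty) :
    dimH S = 2 * ∑ k, dimH (univ : Set (X k)) + 2 ^ K + K := by
  choose n hn using hX
  have hdim : ∀ k, dimH (univ : Set (X k)) = n k := fun k => by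
    have := (hn k).1
    rw [(hn k).isLocallyModelled.dimH_eq (by simp), Module.finrank_fin_fun]
  have hpi := IsLocallyModelled.pi fun k => (hn k).isLocallyModelled
  have h := hpi.prod (hpi.prod
    ((IsLocallyModelled.pi fun _ : Fin K => isLocallyModelled_unitInterval).prod
      (isLocallyModelled_self ((Fin K → Bool) → ℝ))))
  rw [h.dimH_eq hS]
  simp only [hdim, Module.finrank_prod, Module.finrank_pi_fintype, Module.finrank_self,
    Finset.sum_const, Finset.card_univ, Fintype.card_pi, Fintype.card_bool, Fintype.card_fin,
    Finset.prod_const]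
  push_cast
  simp only [smul_eq_mul, mul_one]
  push_cast
  ring

theorem nonempty_parameters {K : ℕ} {X : Fin K → Type*} [∀ k, MetricSpace (X k)]
    (hX : ∀ k, ∃ n : ℕ, IsLocallyParametrized (X k) n) : Nonempty (Parameters X) := by
  have : ∀ k, Nonempty (X k) := fun k => (hX k).choose_spec.1
  infer_instance

end Dimension

/-! ### Two-point measures dominating two means -/

section TwoPoints

variable {Ω : Type*} [MeasurableSpace Ω] {μ : Measure Ω}

theorem not_ae_pos_of_integral_eq_zero [NeZero μ] {f : Ω → ℝ} (hf : Integrable f μ)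
    (h0 : ∫ x, f x ∂μ = 0) : ¬ ∀ᵐ x ∂μ, 0 < f x := by
  intro h
  have h1 := (integral_eq_zero_iff_of_nonneg_ae (h.mono fun x hx => hx.le) hf).1 h0
  obtain ⟨x, hx, hx'⟩ := (h.and h1).exists
  exact hx.ne' hx'

theorem not_ae_neg_of_integral_eq_zero [NeZero μ] {f : Ω → ℝ} (hf : Integrable f μ)
    (h0 : ∫ x, f x ∂μ = 0) : ¬ ∀ᵐ x ∂μ, f x < 0 := by
  intro h
  refine not_ae_pos_of_integral_eq_zero hf.neg (by simp [integral_neg, h0]) ?_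
  exact h.mono fun x hx => by simpa using hx

theorem ae_eq_zero_of_nonpos_of_integral_eq_zero {f : Ω → ℝ} (hf : Integrable f μ)
    (h : ∀ x, f x ≤ 0) (h0 : ∫ x, f x ∂μ = 0) : ∀ᵐ x ∂μ, f x = 0 := by
  have := (integral_eq_zero_iff_of_nonneg (f := fun x => -f x)
    (fun x => by simpa using h x) hf.neg).1 (by simp [integral_neg, h0])
  exact this.mono fun x hx => by simpa using hx

/-- Two functions of mean zero have simultaneously non-negative means under some probability measure
carried by two points. -/
theorem exists_two_point_nonneg [NeZero μ] {h f : Ω → ℝ} (hh : Integrable h μ)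
    (hf : Integrable f μ) (hh0 : ∫ x, h x ∂μ = 0) (hf0 : ∫ x, f x ∂μ = 0) :
    ∃ (x₀ x₁ : Ω) (p : unitInterval), 0 ≤ p * h x₀ + (1 - p) * h x₁ ∧
      0 ≤ p * f x₀ + (1 - p) * f x₁ := by
  by_contra! H
  have hD : ∀ x, 0 ≤ h x → f x < 0 := fun x hx => by
    simpa using H x x 1 (by simpa using hx)
  have hP : ∀ a b, f a < 0 → 0 < f b → h a * f b < h b * f a := by
    intro a b ha hb
    by_contra! hab
    -- The weight `f b / (f b - f a)` on `a` makes the mean of `f` exactly zero, so the mean of `h`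
    -- must be negative.
    have hpos : 0 < f b - f a := by linarith
    have h1 := H a b ⟨f b / (f b - f a), div_nonneg hb.le hpos.le,
      (div_le_one hpos).2 (by linarith)⟩ (by
        have : f b / (f b - f a) * h a + (1 - f b / (f b - f a)) * h b
            = (h a * f b - h b * f a) / (f b - f a) := by field_simp; ring
        simp only [this]
        exact div_nonneg (by linarith) hpos.le)
    have h2 : f b / (f b - f a) * f a + (1 - f b / (f b - f a)) * f b = 0 := by
      field_simp; ring
    simp only [h2] at h1
    exact lt_irrefl _ h1
  by_cases hb : ∀ b, f b ≤ 0
  · have h1 := ae_eq_zero_of_nonpos_of_integral_eq_zero hf hb hf0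
    refine not_ae_neg_of_integral_eq_zero hh hh0 (h1.mono fun x hx => ?_)
    by_contra! hx'
    exact (hD x hx').ne hx
  push Not at hb
  obtain ⟨b₀, hb₀⟩ := hb
  -- The slopes that `c` must exceed for `h + c f ≤ 0` where `f < 0 ≤ h`. Points with `f > 0` bound
  -- them above. `S` may be empty, and then `c = 0`.
  set S : Set ℝ := {r | ∃ a, f a < 0 ∧ 0 ≤ h a ∧ r = h a / (-f a)}
  have hub : ∀ b, 0 < f b → ∀ r ∈ S, r ≤ -h b / f b := by
    rintro b hb r ⟨a, ha, _, rfl⟩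
    rw [div_le_div_iff₀ (by linarith) hb]
    linarith [hP a b ha hb]
  set c := sSup S
  have hc0 : 0 ≤ c := Real.sSup_nonneg fun r ⟨a, ha, ha', hr⟩ =>
    hr ▸ div_nonneg ha' (by linarith)
  have hle : ∀ x, h x + c * f x ≤ 0 := by
    intro x
    rcases lt_trichotomy (f x) 0 with hx | hx | hx
    · by_cases hx' : 0 ≤ h x
      · have : h x / (-f x) ≤ c := le_csSup ⟨_, hub b₀ hb₀⟩ ⟨x, hx, hx', rfl⟩
        rw [div_le_iff₀ (by linarith)] at this
        linarith
      · nlinarith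
    · by_contra! hx'
      exact (hD x (by rw [hx] at hx'; linarith)).ne hx
    · have hn : h x < 0 := by
        by_contra! hx'
        exact (hD x hx').not_gt hx
      have : c ≤ -h x / f x := Real.sSup_le (hub x hx) (div_nonneg (by linarith) hx.le)
      rw [le_div_iff₀ hx] at this
      linarith
  have hae := ae_eq_zero_of_nonpos_of_integral_eq_zero (hh.add (hf.const_mul c)) hle (by
    simp only [Pi.add_apply]
    rw [integral_add hh (hf.const_mul c), integral_const_mul, hh0, hf0]; simp)
  simp only [Pi.add_apply] at hae
  have hne : ∀ x, h x + c * f x = 0 → f x ≠ 0 := fun x hx hx' =>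
    (hD x (by rw [hx'] at hx; linarith)).ne hx'
  -- Two points of the line with `f` of opposite signs would give equality in the strict inequality
  -- `hP`. Hence `f` has one strict sign almost everywhere.
  by_cases ha : ∃ a, f a < 0 ∧ h a + c * f a = 0
  · obtain ⟨a, ha, ha'⟩ := ha
    refine not_ae_neg_of_integral_eq_zero hf hf0 (hae.mono fun x hx => ?_)
    refine lt_of_le_of_ne (not_lt.1 fun hx' => ?_) (hne x hx)
    have := hP a x ha hx'
    rw [eq_neg_of_add_eq_zero_left ha', eq_neg_of_add_eq_zero_left hx] at this
    linarith
  · push Not at ha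
    refine not_ae_pos_of_integral_eq_zero hf hf0 (hae.mono fun x hx => ?_)
    exact lt_of_le_of_ne (not_lt.1 fun hx' => ha x hx' hx) (hne x hx).symm

theorem exists_two_point_ge [IsProbabilityMeasure μ] {h f : Ω → ℝ} (hh : Integrable h μ)
    (hf : Integrable f μ) :
    ∃ (x₀ x₁ : Ω) (p : unitInterval), ∫ x, h x ∂μ ≤ p * h x₀ + (1 - p) * h x₁ ∧
      ∫ x, f x ∂μ ≤ p * f x₀ + (1 - p) * f x₁ := by
  obtain ⟨x₀, x₁, p, h1, h2⟩ := exists_two_point_nonneg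
    (hh.sub (integrable_const (∫ x, h x ∂μ))) (hf.sub (integrable_const (∫ x, f x ∂μ)))
    (by simp [integral_sub hh (integrable_const _)])
    (by simp [integral_sub hf (integrable_const _)])
  refine ⟨x₀, x₁, p, ?_, ?_⟩
  · simp only [Pi.sub_apply] at h1; linarith
  · simp only [Pi.sub_apply] at h2; linarith

end TwoPoints

/-! ### Measures carried by two points -/

section TwoPointMeasure

variable {Z : Type*} [MeasurableSpace Z]

/-- The probability measure `p δ_a + (1 - p) δ_b`. -/
noncomputable def twoPoint (a b : Z) (p : unitInterval) : ProbabilityMeasure Z :=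
  ⟨ENNReal.ofReal p • Measure.dirac a + ENNReal.ofReal (1 - p) • Measure.dirac b,
    ⟨by
      simp only [Measure.coe_add, Measure.coe_smul, Pi.add_apply, Pi.smul_apply, measure_univ,
        smul_eq_mul, mul_one]
      rw [← ENNReal.ofReal_add p.2.1 (by linarith [p.2.2])]
      simp⟩⟩

theorem coe_twoPoint (a b : Z) (p : unitInterval) : (twoPoint a b p : Measure Z) =
    ENNReal.ofReal p • Measure.dirac a + ENNReal.ofReal (1 - p) • Measure.dirac b := rfl

theorem integrable_twoPoint [MeasurableSingletonClass Z] (a b : Z) (p : unitInterval) (f : Z → ℝ) :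
    Integrable f (twoPoint a b p : Measure Z) :=
  ((integrable_dirac (by simp)).smul_measure (by simp)).add_measure
    ((integrable_dirac (by simp)).smul_measure (by simp))

theorem integral_twoPoint [MeasurableSingletonClass Z] (a b : Z) (p : unitInterval) (f : Z → ℝ) :
    ∫ x, f x ∂(twoPoint a b p : Measure Z) = p * f a + (1 - p) * f b := by
  rw [coe_twoPoint, integral_add_measure ((integrable_dirac (by simp)).smul_measure (by simp))
    ((integrable_dirac (by simp)).smul_measure (by simp)), integral_smul_measure,
    integral_smul_measure, integral_dirac, integral_dirac, ENNReal.toReal_ofReal p.2.1,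
    ENNReal.toReal_ofReal (by linarith [p.2.2])]
  simp

/-- A probability measure carried by two points is of the form `p δ_a + (1 - p) δ_b`. -/
theorem exists_eq_twoPoint [MeasurableSingletonClass Z] (ν : ProbabilityMeasure Z) {a b : Z}
    (h : (ν : Measure Z) {a, b}ᶜ = 0) : ∃ p : unitInterval, ν = twoPoint a b p := by
  have hfin : (ν : Measure Z) {a} ≤ 1 := prob_le_one
  set t := ((ν : Measure Z) {a}).toReal
  have hνa : (ν : Measure Z) {a} = ENNReal.ofReal t :=
    (ENNReal.ofReal_toReal (measure_ne_top _ _)).symm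
  have ht1 : t ≤ 1 := ENNReal.toReal_le_of_le_ofReal zero_le_one (by simpa using hfin)
  refine ⟨⟨t, ENNReal.toReal_nonneg, ht1⟩, ProbabilityMeasure.toMeasure_injective ?_⟩
  have hcompl : (ν : Measure Z) {a}ᶜ = ENNReal.ofReal (1 - t) := by
    rw [prob_compl_eq_one_sub (measurableSet_singleton a), hνa,
      ENNReal.ofReal_sub _ ENNReal.toReal_nonneg, ENNReal.ofReal_one]
  ext s hs
  rw [coe_twoPoint]
  simp only [Measure.coe_add, Measure.coe_smul, Pi.add_apply, Pi.smul_apply, smul_eq_mul,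
    Measure.dirac_apply' _ hs]
  -- Split `s` at `a`: the mass off `a` can only sit at `b`. If `a = b`, that mass is zero, so this
  -- case needs no separate treatment.
  rw [← hνa, ← hcompl, ← measure_inter_add_sdiff s (measurableSet_singleton a)]
  congr 1
  · by_cases ha : a ∈ s
    · rw [inter_eq_right.2 (singleton_subset_iff.2 ha)]; simp [ha]
    · rw [inter_singleton_eq_empty.2 ha]; simp [ha]
  · have hnull : ∀ u : Set Z, u ∩ {a, b} = ∅ → (ν : Measure Z) u = 0 := fun u hu =>
      measure_mono_null (subset_compl_iff_disjoint_right.2 (disjoint_iff_inter_eq_empty.2 hu)) h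
    by_cases hb : b ∈ s
    · simp only [hb, indicator_of_mem, Pi.one_apply, mul_one]
      refine measure_congr (ae_eq_set.2 ⟨?_, hnull _ ?_⟩)
      · rw [sdiff_eq_empty.2 fun x hx => hx.2, measure_empty]
      · ext x
        simp only [mem_inter_iff, mem_sdiff, mem_compl_iff, mem_singleton_iff, not_and, not_not,
          mem_insert_iff, mem_empty_iff_false, iff_false, not_or]
        rintro ⟨hxa, hxs⟩
        exact ⟨hxa, fun hxb => hxa (hxs (hxb ▸ hb))⟩
    · simp only [hb, not_false_eq_true, indicator_of_notMem, mul_zero]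
      refine hnull _ ?_
      ext x
      simp only [mem_inter_iff, mem_sdiff, mem_singleton_iff, mem_insert_iff,
        mem_empty_iff_false, iff_false, not_and, not_or]
      rintro ⟨hxs, hxa⟩
      exact ⟨hxa, fun hxb => hb (hxb ▸ hxs)⟩

end TwoPointMeasure

/-! ### Products of two-point measures -/

section ProductMeasure

variable {K : ℕ} {X : Fin K → Type*} [∀ k, MeasurableSpace (X k)]

theorem twoPointProduct_eq_pi (x₀ x₁ : ∀ k, X k) (p : Fin K → unitInterval) :
    twoPointProduct x₀ x₁ p =
      Measure.pi fun k => (twoPoint (x₀ k) (x₁ k) (p k) : Measure (X k)) := rfl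

theorem isProductProbability_twoPointProduct (x₀ x₁ : ∀ k, X k) (p : Fin K → unitInterval) :
    IsProductProbability (twoPointProduct x₀ x₁ p) :=
  ⟨fun k => twoPoint (x₀ k) (x₁ k) (p k), rfl⟩

theorem weight_nonneg (p : Fin K → unitInterval) (ε : Fin K → Bool) : 0 ≤ weight p ε :=
  Finset.prod_nonneg fun k _ => by
    split_ifs
    · linarith [(p k).2.2]
    · exact (p k).2.1

theorem twoPointProduct_eq_sum (x₀ x₁ : ∀ k, X k) (p : Fin K → unitInterval) :
    twoPointProduct x₀ x₁ p =
      ∑ ε, ENNReal.ofReal (weight p ε) • Measure.dirac (vertex x₀ x₁ ε) := by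
  rw [twoPointProduct_eq_pi]
  refine Measure.pi_eq fun s hs => ?_
  have key : ∀ k, (twoPoint (x₀ k) (x₁ k) (p k) : Measure (X k)) (s k) =
      ∑ b : Bool, ENNReal.ofReal (if b then 1 - (p k : ℝ) else p k) *
        (s k).indicator 1 (if b then x₁ k else x₀ k) := fun k => by
    rw [coe_twoPoint]
    simp [Measure.dirac_apply' _ (hs k), add_comm]
  simp_rw [key]
  -- On a box, distributivity turns the product of binary sums into a sum over choices `ε`.
  -- Coinciding vertices simply contribute several terms.
  rw [Finset.prod_univ_sum, Fintype.piFinset_univ]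
  simp only [Measure.coe_finsetSum, Finset.sum_apply, Measure.coe_smul, Pi.smul_apply,
    smul_eq_mul]
  refine Finset.sum_congr rfl fun ε _ => ?_
  rw [Finset.prod_mul_distrib, weight, ENNReal.ofReal_prod_of_nonneg,
    Measure.dirac_apply' _ (MeasurableSet.univ_pi hs)]
  · congr 1
    by_cases h : vertex x₀ x₁ ε ∈ univ.pi s
    · rw [indicator_of_mem h]
      refine (Finset.prod_eq_one fun k _ => ?_).symm
      exact indicator_of_mem (h k (mem_univ k)) _
    · rw [indicator_of_notMem h]
      simp only [mem_univ_pi, not_forall] at h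
      obtain ⟨k, hk⟩ := h
      exact (Finset.prod_eq_zero (Finset.mem_univ k) (indicator_of_notMem hk _)).symm
  · intro k _
    split_ifs
    · linarith [(p k).2.2]
    · exact (p k).2.1

variable [∀ k, MeasurableSingletonClass (X k)]

theorem integral_twoPointProduct (x₀ x₁ : ∀ k, X k) (p : Fin K → unitInterval)
    (f : (∀ k, X k) → ℝ) :
    ∫ x, f x ∂(twoPointProduct x₀ x₁ p) = ∑ ε, weight p ε * f (vertex x₀ x₁ ε) := by
  rw [twoPointProduct_eq_sum, integral_finsetSum_measure fun ε _ =>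
    (integrable_dirac (by simp)).smul_measure (by simp)]
  refine Finset.sum_congr rfl fun ε _ => ?_
  rw [integral_smul_measure, integral_dirac, ENNReal.toReal_ofReal (weight_nonneg p ε), smul_eq_mul]

theorem integrable_twoPointProduct (x₀ x₁ : ∀ k, X k) (p : Fin K → unitInterval)
    (f : (∀ k, X k) → ℝ) : Integrable f (twoPointProduct x₀ x₁ p) := by
  rw [twoPointProduct_eq_sum, integrable_finsetSum_measure]
  exact fun ε _ => (integrable_dirac (by simp)).smul_measure (by simp)

theorem twoPointProduct_compl_cube (x₀ x₁ : ∀ k, X k) (p : Fin K → unitInterval) :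
    twoPointProduct x₀ x₁ p (cube x₀ x₁)ᶜ = 0 := by
  rw [twoPointProduct_eq_sum]
  simp only [Measure.coe_finsetSum, Finset.sum_apply, Measure.coe_smul, Pi.smul_apply,
    smul_eq_mul]
  refine Finset.sum_eq_zero fun ε _ => ?_
  have : vertex x₀ x₁ ε ∉ (cube x₀ x₁)ᶜ := fun h => h ⟨ε, rfl⟩
  rw [Measure.dirac_apply, indicator_of_notMem this, mul_zero]

/-- The `k`-th marginal of `μ` is `ν k`, and the cube projects into `{x₀ k, x₁ k}`, so every factor
is carried by two points. -/
theorem exists_eq_twoPointProduct {μ : Measure (∀ k, X k)} (hμ : IsProductProbability μ)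
    {x₀ x₁ : ∀ k, X k} (h : μ (cube x₀ x₁)ᶜ = 0) :
    ∃ p : Fin K → unitInterval, μ = twoPointProduct x₀ x₁ p := by
  obtain ⟨ν, rfl⟩ := hμ
  have hk : ∀ k, ∃ p, ν k = twoPoint (x₀ k) (x₁ k) p := fun k => by
    refine exists_eq_twoPoint (ν k) ?_
    have hm : MeasurableSet ({x₀ k, x₁ k}ᶜ : Set (X k)) := (Set.toFinite _).measurableSet.compl
    rw [← (measurePreserving_eval (fun k => (ν k : Measure (X k))) k).measure_preimage
      hm.nullMeasurableSet]
    refine measure_mono_null ?_ h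
    rintro _ hx ⟨ε, rfl⟩
    refine hx ?_
    simp only [Function.eval, vertex]
    split_ifs <;> simp
  choose p hp using hk
  refine ⟨p, ?_⟩
  rw [twoPointProduct_eq_pi]
  simp_rw [← hp]

end ProductMeasure

/-! ### Replacing the factors of a product measure -/

section Replacement

variable {ι : Type*} [Fintype ι] [DecidableEq ι] {X : ι → Type*} [∀ i, MeasurableSpace (X i)]

/-- Resampling: draw `x` from the old product and `t` from `ρ` independently, then overwrite
coordinate `i`. The discarded coordinate contributes total mass one, so the index set need not be
split. -/
theorem pi_update_eq_map (ν : ∀ i, ProbabilityMeasure (X i)) (i : ι) (ρ : ProbabilityMeasure (X i)) :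
    Measure.pi (fun j => (Function.update ν i ρ j : Measure (X j))) =
      ((ρ : Measure (X i)).prod (Measure.pi fun j => (ν j : Measure (X j)))).map
        (fun z => Function.update z.2 i z.1) := by
  have hmeas : Measurable fun z : X i × (∀ j, X j) => Function.update z.2 i z.1 :=
    measurable_update'.comp measurable_swap
  refine Measure.pi_eq fun s hs => ?_
  rw [Measure.map_apply hmeas (MeasurableSet.univ_pi hs)]
  have : (fun z : X i × (∀ j, X j) => Function.update z.2 i z.1) ⁻¹' univ.pi s =
      s i ×ˢ univ.pi (Function.update s i univ) := by
    ext ⟨t, x⟩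
    simp only [mem_preimage, mem_univ_pi, mem_prod]
    constructor
    · intro h
      refine ⟨by simpa using h i, fun j => ?_⟩
      rcases eq_or_ne j i with rfl | hj
      · simp
      · simpa [hj] using h j
    · rintro ⟨h, h'⟩ j
      rcases eq_or_ne j i with rfl | hj
      · simpa using h
      · simpa [hj] using h' j
  rw [this, Measure.prod_prod, Measure.pi_pi, ← Finset.mul_prod_erase _ _ (Finset.mem_univ i),
    ← Finset.mul_prod_erase _ _ (Finset.mem_univ i)]
  simp only [Function.update_self, measure_univ, one_mul]
  congr 1
  refine Finset.prod_congr rfl fun j hj => ?_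
  have hj' : j ≠ i := Finset.ne_of_mem_erase hj
  simp [hj']

theorem measurePreserving_update (ν : ∀ i, ProbabilityMeasure (X i)) (i : ι)
    (ρ : ProbabilityMeasure (X i)) :
    MeasurePreserving (fun z : X i × (∀ j, X j) => Function.update z.2 i z.1)
      ((ρ : Measure (X i)).prod (Measure.pi fun j => (ν j : Measure (X j))))
      (Measure.pi fun j => (Function.update ν i ρ j : Measure (X j))) :=
  ⟨measurable_update'.comp measurable_swap, (pi_update_eq_map ν i ρ).symm⟩

theorem integral_pi_update (ν : ∀ i, ProbabilityMeasure (X i)) (i : ι)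
    (ρ : ProbabilityMeasure (X i)) {f : (∀ j, X j) → ℝ}
    (hf : Integrable f (Measure.pi fun j => (Function.update ν i ρ j : Measure (X j)))) :
    ∫ x, f x ∂(Measure.pi fun j => (Function.update ν i ρ j : Measure (X j))) =
      ∫ t, ∫ x, f (Function.update x i t) ∂(Measure.pi fun j => (ν j : Measure (X j)))
        ∂(ρ : Measure (X i)) := by
  have hmp := measurePreserving_update ν i ρ
  rw [← hmp.map_eq, integral_map hmp.measurable.aemeasurable (by rw [hmp.map_eq]; exact hf.1),
    integral_prod (fun z : X i × (∀ j, X j) => f (Function.update z.2 i z.1))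
      (hmp.integrable_comp_of_integrable hf)]

/-- One factor of a product measure can be replaced by a measure carried by two points without
lowering the means of two given functions. -/
theorem exists_update_twoPoint [∀ i, MeasurableSingletonClass (X i)]
    (ν : ∀ i, ProbabilityMeasure (X i)) (i : ι)
    {g f : (∀ j, X j) → ℝ} (hgm : Measurable g) (hfm : Measurable f)
    {c : X i → X i → ℝ}
    (hc : ∀ x s t, |g (Function.update x i s) - g (Function.update x i t)| ≤ c s t)
    {B : ℝ} (hB : ∀ x, ‖f x‖ ≤ B)
    (hg : Integrable g (Measure.pi fun j => (ν j : Measure (X j)))) :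
    ∃ (a b : X i) (p : unitInterval),
      Integrable g (Measure.pi fun j =>
        (Function.update ν i (twoPoint a b p) j : Measure (X j))) ∧
      ∫ x, g x ∂(Measure.pi fun j => (ν j : Measure (X j))) ≤
        ∫ x, g x ∂(Measure.pi fun j =>
          (Function.update ν i (twoPoint a b p) j : Measure (X j))) ∧
      ∫ x, f x ∂(Measure.pi fun j => (ν j : Measure (X j))) ≤
        ∫ x, f x ∂(Measure.pi fun j =>
          (Function.update ν i (twoPoint a b p) j : Measure (X j))) := by
  -- Viewing `ν` as updated by its own factor lets one Fubini formula serve the old and the new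
  -- measure.
  have hself : Measure.pi (fun j => (ν j : Measure (X j))) =
      Measure.pi fun j => (Function.update ν i (ν i) j : Measure (X j)) := by
    rw [Function.update_eq_self]
  have hfint : ∀ ν' : ∀ i, ProbabilityMeasure (X i),
      Integrable f (Measure.pi fun j => (ν' j : Measure (X j))) := fun ν' =>
    Integrable.of_bound hfm.aestronglyMeasurable B (Filter.Eventually.of_forall hB)
  have hum : ∀ t, Measurable fun x : ∀ j, X j => Function.update x i t := fun t =>
    measurable_update_left
  have hg' := (measurePreserving_update ν i (ν i)).integrable_comp_of_integrable (hself ▸ hg)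
  have hf' := (measurePreserving_update ν i (ν i)).integrable_comp_of_integrable
    (hself ▸ hfint ν)
  -- Fubini gives integrability of almost every section only, but the atoms `a`, `b` may be
  -- exceptional. Sections differ by bounded functions, so one integrable section suffices.
  have hsec : ∀ t, Integrable (fun x => g (Function.update x i t))
      (Measure.pi fun j => (ν j : Measure (X j))) := by
    obtain ⟨s, hs⟩ := hg'.prod_right_ae.exists
    intro t
    have h1 : Integrable (fun x => g (Function.update x i t) - g (Function.update x i s))
        (Measure.pi fun j => (ν j : Measure (X j))) :=
      Integrable.of_bound ((hgm.comp (hum t)).sub (hgm.comp (hum s))).aestronglyMeasurable (c t s)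
        (Filter.Eventually.of_forall fun x => hc x t s)
    simpa [Pi.add_def] using h1.add hs
  obtain ⟨a, b, p, hga, hfa⟩ := exists_two_point_ge hg'.integral_prod_left hf'.integral_prod_left
  have hgu : Integrable g (Measure.pi fun j =>
      (Function.update ν i (twoPoint a b p) j : Measure (X j))) := by
    have hmp := measurePreserving_update ν i (twoPoint a b p)
    rw [← hmp.integrable_comp hgm.aestronglyMeasurable]
    rw [integrable_prod_iff (hgm.comp hmp.measurable).aestronglyMeasurable]
    exact ⟨Filter.Eventually.of_forall hsec, integrable_twoPoint _ _ _ _⟩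
  refine ⟨a, b, p, hgu, ?_, ?_⟩
  · rw [integral_pi_update ν i _ hgu, integral_twoPoint, hself,
      integral_pi_update ν i _ (hself ▸ hg)]
    simpa using hga
  · rw [integral_pi_update ν i _ (hfint _), integral_twoPoint, hself,
      integral_pi_update ν i _ (hself ▸ hfint ν)]
    simpa using hfa

/-- All factors of a product measure can be replaced by measures carried by two points without
lowering the means of two given functions. -/
theorem exists_forall_twoPoint [∀ i, MeasurableSingletonClass (X i)]
    (ν : ∀ i, ProbabilityMeasure (X i))
    {g f : (∀ j, X j) → ℝ} (hgm : Measurable g) (hfm : Measurable f)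
    {c : ∀ i, X i → X i → ℝ}
    (hc : ∀ i x s t, |g (Function.update x i s) - g (Function.update x i t)| ≤ c i s t)
    {B : ℝ} (hB : ∀ x, ‖f x‖ ≤ B)
    (hg : Integrable g (Measure.pi fun j => (ν j : Measure (X j)))) :
    ∃ (x₀ x₁ : ∀ i, X i) (p : ι → unitInterval),
      ∫ x, g x ∂(Measure.pi fun j => (ν j : Measure (X j))) ≤
        ∫ x, g x ∂(Measure.pi fun j => (twoPoint (x₀ j) (x₁ j) (p j) : Measure (X j))) ∧
      ∫ x, f x ∂(Measure.pi fun j => (ν j : Measure (X j))) ≤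
        ∫ x, f x ∂(Measure.pi fun j => (twoPoint (x₀ j) (x₁ j) (p j) : Measure (X j))) := by
  -- Induction on the set of replaced coordinates. Integrability of `g` is carried along; the bounds
  -- `c` and `B` do not depend on the measure.
  have key : ∀ s : Finset ι, ∃ ν' : ∀ i, ProbabilityMeasure (X i),
      (∀ i ∈ s, ∃ a b p, ν' i = twoPoint a b p) ∧
      Integrable g (Measure.pi fun j => (ν' j : Measure (X j))) ∧
      ∫ x, g x ∂(Measure.pi fun j => (ν j : Measure (X j))) ≤
        ∫ x, g x ∂(Measure.pi fun j => (ν' j : Measure (X j))) ∧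
      ∫ x, f x ∂(Measure.pi fun j => (ν j : Measure (X j))) ≤
        ∫ x, f x ∂(Measure.pi fun j => (ν' j : Measure (X j))) := by
    intro s
    induction s using Finset.induction_on with
    | empty => exact ⟨ν, by simp, hg, le_rfl, le_rfl⟩
    | insert i s _ ih =>
      obtain ⟨ν', h1, h2, h3, h4⟩ := ih
      obtain ⟨a, b, p, h5, h6, h7⟩ := exists_update_twoPoint ν' i hgm hfm (hc i) hB h2
      refine ⟨_, fun j hj => ?_, h5, h3.trans h6, h4.trans h7⟩
      rcases eq_or_ne j i with rfl | hji
      · exact ⟨a, b, p, by simp⟩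
      · simpa [hji] using h1 j (Finset.mem_of_mem_insert_of_ne hj hji)
  obtain ⟨ν', h1, -, h3, h4⟩ := key Finset.univ
  choose x₀ x₁ p hp using fun i => h1 i (Finset.mem_univ i)
  simp_rw [hp] at h3 h4
  exact ⟨x₀, x₁, p, h3, h4⟩

end Replacement

/-! ### Short functions and their extension -/

section QuasiMetric

variable {K : ℕ} {X : Fin K → Type*} [∀ k, MetricSpace (X k)] {L : Fin K → ℝ}

theorem dL_self (L : Fin K → ℝ) (x : ∀ k, X k) : dL L x x = 0 := by simp [dL]

theorem dL_comm (L : Fin K → ℝ) (x y : ∀ k, X k) : dL L x y = dL L y x := by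
  simp [dL, dist_comm]

theorem dL_triangle (hL : ∀ k, 0 ≤ L k) (x y z : ∀ k, X k) :
    dL L x z ≤ dL L x y + dL L y z := by
  simp only [dL, ← Finset.sum_add_distrib, ← mul_add]
  exact Finset.sum_le_sum fun k _ => mul_le_mul_of_nonneg_left (dist_triangle _ _ _) (hL k)

theorem dL_update [DecidableEq (Fin K)] (L : Fin K → ℝ) (x : ∀ k, X k) (i : Fin K) (s t : X i) :
    dL L (Function.update x i s) (Function.update x i t) = L i * dist s t := by
  rw [dL, Finset.sum_eq_single i]
  · simp
  · intro j _ hj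
    simp [hj]
  · simp

theorem IsShort.continuous (hL : ∀ k, 0 ≤ L k) {g : (∀ k, X k) → ℝ} (hg : IsShort L g) :
    Continuous g := by
  refine (LipschitzWith.of_dist_le' (K := ∑ k, L k) fun x y => ?_).continuous
  rw [Real.dist_eq]
  refine (hg x y).trans ?_
  rw [dL, Finset.sum_mul]
  exact Finset.sum_le_sum fun k _ => mul_le_mul_of_nonneg_left (dist_le_pi_dist x y k) (hL k)

/-- McShane's extension theorem for `d_L`-short functions. -/
theorem IsShortOn.exists_extension (hL : ∀ k, 0 ≤ L k) {D : Set (∀ k, X k)} (hD : D.Nonempty)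
    {g : D → ℝ} (hg : IsShortOn L D g) :
    ∃ g' : (∀ k, X k) → ℝ, IsShort L g' ∧ ∀ z : D, g' z = g z := by
  have : Nonempty D := hD.to_subtype
  -- Shortness against one fixed `z₀` bounds the family below, so the real infimum is genuine.
  have hbdd : ∀ x : ∀ k, X k, BddBelow (range fun z : D => g z + dL L x z) := by
    intro x
    obtain ⟨z₀⟩ := this
    refine ⟨g z₀ - dL L x z₀, ?_⟩
    rintro _ ⟨z, rfl⟩
    have h1 := (abs_le.1 (hg z₀ z)).2
    have h2 := dL_triangle hL (z₀ : ∀ k, X k) x z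
    rw [dL_comm L z₀ x] at h2
    simp only
    linarith
  have hle : ∀ x y : ∀ k, X k, (⨅ z : D, g z + dL L x z) ≤ (⨅ z : D, g z + dL L y z) + dL L x y := by
    intro x y
    rw [← sub_le_iff_le_add]
    refine le_ciInf fun z => ?_
    have h1 := ciInf_le (hbdd x) z
    have h2 := dL_triangle hL x y (z : ∀ k, X k)
    linarith
  refine ⟨fun x => ⨅ z : D, g z + dL L x z, fun x y => abs_le.2 ⟨?_, ?_⟩, fun z => ?_⟩
  · have := hle y x
    rw [dL_comm] at this
    linarith
  · linarith [hle x y]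
  · apply le_antisymm
    · simpa [dL_self] using ciInf_le (hbdd (z : ∀ k, X k)) z
    · refine le_ciInf fun w => ?_
      linarith [(abs_le.1 (hg z w)).2]

end QuasiMetric

/-! ### Equivalence of the full and reduced problems -/

section Reduction

variable {K : ℕ} {X : Fin K → Type*} [∀ k, MeasurableSpace (X k)]

theorem extend_ae_eq {O : Set (∀ k, X k)} {x₀ x₁ : ∀ k, X k} {μ : Measure (∀ k, X k)}
    (hμ : μ (cube x₀ x₁)ᶜ = 0) {g : ↥(cube x₀ x₁ ∪ O) → ℝ} {g' : (∀ k, X k) → ℝ}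
    (h : ∀ z : ↥(cube x₀ x₁ ∪ O), g' z = g z) :
    Function.extend Subtype.val g 0 =ᵐ[μ] g' := by
  filter_upwards [compl_mem_ae_iff.2 hμ] with x hx
  rw [compl_compl] at hx
  have := Subtype.val_injective.extend_apply g 0 (⟨x, Or.inl hx⟩ : ↥(cube x₀ x₁ ∪ O))
  simp only at this
  rw [this, ← h]

/-- Points of `O` off the cube may enter the reduced failure set, but they form a null set. -/
theorem reducedFailureProb_eq {O : Set (∀ k, X k)} {x₀ x₁ : ∀ k, X k} {μ : Measure (∀ k, X k)}
    (hμ : μ (cube x₀ x₁)ᶜ = 0) {g : ↥(cube x₀ x₁ ∪ O) → ℝ} {g' : (∀ k, X k) → ℝ}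
    (h : ∀ z : ↥(cube x₀ x₁ ∪ O), g' z = g z) (θ : ℝ) :
    reducedFailureProb θ (⟨(x₀, x₁), (g, μ)⟩ : ReducedScenario O) = failureProb θ (g', μ) := by
  refine measure_congr ?_
  filter_upwards [compl_mem_ae_iff.2 hμ] with x hx
  rw [compl_compl] at hx
  refine propext ⟨?_, fun hx' => ⟨⟨x, Or.inl hx⟩, ?_, rfl⟩⟩
  · rintro ⟨z, hz, rfl⟩
    change g' z ≤ θ
    rw [h]
    exact hz
  · change g _ ≤ θ
    rw [← h]
    exact hx'

variable [∀ k, MetricSpace (X k)] [∀ k, BorelSpace (X k)] {L : Fin K → ℝ} {G : (∀ k, X k) → ℝ} {O : Set (∀ k, X k)}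
  {m : ℝ}

theorem exists_admissible_of_reduced (hL : ∀ k, 0 ≤ L k) (θ : ℝ) {q : ReducedScenario O}
    (hq : q ∈ reducedAdmissible L G O m) :
    ∃ q' ∈ admissible L G O m, failureProb θ q' = reducedFailureProb θ q := by
  obtain ⟨⟨x₀, x₁⟩, g, μ⟩ := q
  obtain ⟨h1, h2, h3, h4, h5⟩ := hq
  obtain ⟨g', hg', hgg'⟩ := h1.exists_extension hL ⟨_, Or.inl ⟨fun _ => false, rfl⟩⟩
  refine ⟨(g', μ), ⟨hg', h2, fun z hz => ?_, ?_, ?_⟩, (reducedFailureProb_eq h3 hgg' θ).symm⟩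
  · rw [← h4 z hz]
    exact hgg' ⟨z, Or.inr hz⟩
  · dsimp only at h2 h3
    obtain ⟨p, rfl⟩ := exists_eq_twoPointProduct h2 h3
    exact integrable_twoPointProduct _ _ _ _
  · exact h5.trans_eq (integral_congr_ae (extend_ae_eq h3 hgg'))

/-- Every scenario can be replaced by one whose measure is a product of two-point measures, without
lowering the mean of a given bounded function. -/
theorem exists_reduced_of_admissible [∀ k, SecondCountableTopology (X k)] (hL : ∀ k, 0 ≤ L k)
    (θ : ℝ) {q : ((∀ k, X k) → ℝ) × Measure (∀ k, X k)} (hq : q ∈ admissible L G O m)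
    {f : (∀ k, X k) → ℝ} (hf : Measurable f) {B : ℝ} (hB : ∀ x, ‖f x‖ ≤ B) :
    ∃ q' ∈ reducedAdmissible L G O m, IsProbabilityMeasure q'.2.2 ∧
      reducedFailureProb θ q' = failureProb θ (q.1, q'.2.2) ∧
      ∫ x, f x ∂q.2 ≤ ∫ x, f x ∂q'.2.2 := by
  obtain ⟨g, μ⟩ := q
  obtain ⟨h1, ⟨ν, rfl⟩, h3, h4, h5⟩ := hq
  obtain ⟨x₀, x₁, p, h6, h7⟩ := exists_forall_twoPoint ν (h1.continuous hL).measurable hf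
    (c := fun i s t => L i * dist s t)
    (fun i x s t => (h1 _ _).trans_eq (dL_update L x i s t)) hB h4
  rw [← twoPointProduct_eq_pi] at h6 h7
  have hnull := twoPointProduct_compl_cube x₀ x₁ p
  have hres : ∀ z : ↥(cube x₀ x₁ ∪ O), g z = (fun z : ↥(cube x₀ x₁ ∪ O) => g z) z :=
    fun _ => rfl
  refine ⟨⟨(x₀, x₁), fun z => g z, twoPointProduct x₀ x₁ p⟩,
    ⟨fun x x' => h1 x x', isProductProbability_twoPointProduct x₀ x₁ p, hnull,
      fun z hz => h3 z hz, ?_⟩, ?_, reducedFailureProb_eq hnull hres θ, h7⟩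
  · exact (h5.trans h6).trans_eq (integral_congr_ae (extend_ae_eq hnull hres)).symm
  · change IsProbabilityMeasure (twoPointProduct x₀ x₁ p)
    rw [twoPointProduct_eq_pi]
    infer_instance

theorem iSup_failureProb_eq [∀ k, SecondCountableTopology (X k)] (hL : ∀ k, 0 ≤ L k) (θ : ℝ) :
    (⨆ q ∈ admissible L G O m, failureProb θ q) =
      ⨆ q ∈ reducedAdmissible L G O m, reducedFailureProb θ q := by
  apply le_antisymm
  · refine iSup₂_le fun q hq => ?_
    have hms : MeasurableSet {x | q.1 x ≤ θ} :=
      (hq.1.continuous hL).measurable measurableSet_Iic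
    obtain ⟨q', hq', hprob, h1, h2⟩ := exists_reduced_of_admissible hL θ hq
      (f := {x | q.1 x ≤ θ}.indicator 1) (measurable_one.indicator hms) (B := 1)
      (fun x => (norm_indicator_le_norm_self 1 x).trans (by simp))
    refine le_iSup₂_of_le q' hq' ?_
    have : IsFiniteMeasure q.2 := by
      obtain ⟨ν, hν⟩ := hq.2.1
      rw [hν]; infer_instance
    rw [integral_indicator_one hms, integral_indicator_one hms] at h2
    rw [h1]
    exact (ENNReal.toReal_le_toReal (measure_ne_top _ _) (measure_ne_top _ _)).1 h2
  · refine iSup₂_le fun q hq => ?_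
    obtain ⟨q', hq', h⟩ := exists_admissible_of_reduced hL θ hq
    exact le_iSup₂_of_le q' hq' h.ge

theorem iInf_failureProb_eq [∀ k, SecondCountableTopology (X k)] (hL : ∀ k, 0 ≤ L k) (θ : ℝ) :
    (⨅ q ∈ admissible L G O m, failureProb θ q) =
      ⨅ q ∈ reducedAdmissible L G O m, reducedFailureProb θ q := by
  apply le_antisymm
  · refine le_iInf₂ fun q hq => ?_
    obtain ⟨q', hq', h⟩ := exists_admissible_of_reduced hL θ hq
    exact iInf₂_le_of_le q' hq' h.le
  · refine le_iInf₂ fun q hq => ?_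
    have hms : MeasurableSet {x | q.1 x ≤ θ} :=
      (hq.1.continuous hL).measurable measurableSet_Iic
    obtain ⟨q', hq', hprob, h1, h2⟩ := exists_reduced_of_admissible hL θ hq
      -- Not lowering the mean of the negated indicator means not raising the failure probability.
      (f := fun x => -{x | q.1 x ≤ θ}.indicator 1 x) (measurable_one.indicator hms).neg (B := 1)
      (fun x => by
        rw [norm_neg]
        exact (norm_indicator_le_norm_self 1 x).trans (by simp))
    refine iInf₂_le_of_le q' hq' ?_
    have : IsFiniteMeasure q.2 := by
      obtain ⟨ν, hν⟩ := hq.2.1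
      rw [hν]; infer_instance
    rw [integral_neg, integral_neg, neg_le_neg_iff, integral_indicator_one hms,
      integral_indicator_one hms] at h2
    rw [h1]
    exact (ENNReal.toReal_le_toReal (measure_ne_top _ _) (measure_ne_top _ _)).1 h2

theorem integral_extend_twoPointProduct (x₀ x₁ : ∀ k, X k) (p : Fin K → unitInterval)
    (g : ↥(cube x₀ x₁ ∪ O) → ℝ) :
    ∫ x, Function.extend Subtype.val g 0 x ∂(twoPointProduct x₀ x₁ p) =
      ∑ ε, weight p ε * g (cubePoint O x₀ x₁ ε) := by
  rw [integral_twoPointProduct]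
  refine Finset.sum_congr rfl fun ε _ => ?_
  rw [← Subtype.val_injective.extend_apply g 0 (cubePoint O x₀ x₁ ε)]
  rfl

theorem exists_parameters_of_reducedAdmissible {x₀ x₁ : ∀ k, X k} {g : ↥(cube x₀ x₁ ∪ O) → ℝ}
    {μ : Measure (∀ k, X k)}
    (h : (⟨(x₀, x₁), (g, μ)⟩ : ReducedScenario O) ∈ reducedAdmissible L G O m) :
    ∃ p : Fin K → unitInterval, μ = twoPointProduct x₀ x₁ p ∧
      (x₀, x₁, p, fun ε => g (cubePoint O x₀ x₁ ε)) ∈ feasible L G O m := by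
  obtain ⟨h1, h2, h3, h4, h5⟩ := h
  dsimp only at h2 h3
  obtain ⟨p, rfl⟩ := exists_eq_twoPointProduct h2 h3
  refine ⟨p, rfl, fun ε ε' => h1 _ _, fun ε z hz => ?_, ?_⟩
  · rw [← h4 z hz]
    exact h1 _ ⟨z, Or.inr hz⟩
  · exact h5.trans_eq (integral_extend_twoPointProduct x₀ x₁ p g)

/-- Vertices may coincide with each other or lie in `O`. There the feasibility inequalities have
right-hand side `dL L x x = 0`, so the prescribed values agree and the choice of `ε` in the
definition of `g` is immaterial. -/
theorem existsUnique_of_feasible (hG : IsShort L G) {x₀ x₁ : ∀ k, X k} {p : Fin K → unitInterval}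
    {y : (Fin K → Bool) → ℝ} (h : (x₀, x₁, p, y) ∈ feasible L G O m) :
    ∃! g : ↥(cube x₀ x₁ ∪ O) → ℝ,
      (⟨(x₀, x₁), (g, twoPointProduct x₀ x₁ p)⟩ : ReducedScenario O)
          ∈ reducedAdmissible L G O m ∧
        ∀ ε, g (cubePoint O x₀ x₁ ε) = y ε := by
  classical
  obtain ⟨h1, h2, h3⟩ := h
  have heq : ∀ {a b : ℝ} {x : ∀ k, X k}, |a - b| ≤ dL L x x → a = b := fun {a b x} hab => by
    rw [dL_self] at hab
    exact sub_eq_zero.1 (abs_nonpos_iff.1 hab)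
  set g : ↥(cube x₀ x₁ ∪ O) → ℝ := fun z =>
    if hz : (z : ∀ k, X k) ∈ cube x₀ x₁ then y hz.choose else G z with hg_def
  have hgy : ∀ (z : ↥(cube x₀ x₁ ∪ O)) ε, vertex x₀ x₁ ε = z → g z = y ε := by
    intro z ε hz
    have hmem : (z : ∀ k, X k) ∈ cube x₀ x₁ := ⟨ε, hz⟩
    simp only [hg_def, dif_pos hmem]
    refine heq (x := z) ((h1 _ _).trans_eq ?_)
    rw [hmem.choose_spec, hz]
  have hgG : ∀ z : ↥(cube x₀ x₁ ∪ O), (z : ∀ k, X k) ∈ O → g z = G z := by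
    intro z hz
    by_cases hmem : (z : ∀ k, X k) ∈ cube x₀ x₁
    · obtain ⟨ε, hε⟩ := hmem
      rw [hgy z ε hε]
      refine heq (x := z) ((h2 ε z hz).trans_eq ?_)
      rw [hε]
    · simp only [hg_def, dif_neg hmem]
  have hshort : IsShortOn L (cube x₀ x₁ ∪ O) g := by
    intro z w
    rcases z.2 with ⟨ε, hε⟩ | hz <;> rcases w.2 with ⟨ε', hε'⟩ | hw
    · rw [hgy z ε hε, hgy w ε' hε', ← hε, ← hε']
      exact h1 _ _
    · rw [hgy z ε hε, hgG w hw, ← hε]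
      exact h2 _ _ hw
    · rw [hgG z hz, hgy w ε' hε', ← hε', abs_sub_comm, dL_comm]
      exact h2 _ _ hz
    · rw [hgG z hz, hgG w hw]
      exact hG _ _
  have hcp : ∀ ε, g (cubePoint O x₀ x₁ ε) = y ε := fun ε => hgy _ ε rfl
  refine ⟨g, ⟨⟨hshort, isProductProbability_twoPointProduct x₀ x₁ p,
    twoPointProduct_compl_cube x₀ x₁ p, fun z hz => hgG _ hz, ?_⟩, hcp⟩, ?_⟩
  · refine h3.trans_eq (Eq.symm ?_)
    refine (integral_extend_twoPointProduct x₀ x₁ p g).trans ?_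
    simp_rw [hcp]
  · rintro g' ⟨⟨-, -, -, h4, -⟩, h5⟩
    funext z
    rcases z.2 with ⟨ε, hε⟩ | hz
    · rw [hgy z ε hε, ← h5 ε]
      congr 1
      exact Subtype.ext hε.symm
    · rw [hgG z hz]
      exact h4 z hz

end Reduction

theorem IsRadonSpace.secondCountableTopology {Z : Type*} [MetricSpace Z] [MeasurableSpace Z]
    [BorelSpace Z] (h : IsRadonSpace Z) : SecondCountableTopology Z :=
  have := h.1
  UniformSpace.secondCountable_of_separable Z

end LegacyUQ

theorem mainTheorem1 {K : ℕ} (X : Fin K → Type*) [∀ k, MetricSpace (X k)]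
    [∀ k, MeasurableSpace (X k)] [∀ k, BorelSpace (X k)]
    (hX : ∀ k, IsRadonSpace (X k))
    (L : Fin K → ℝ) (hL : ∀ k, 0 ≤ L k)
    (G : (∀ k, X k) → ℝ) (hG : IsShort L G)
    (O : Set (∀ k, X k)) (m θ : ℝ) :
    -- equality of the extreme values
    (⨆ q ∈ admissible L G O m, failureProb θ q)
        = (⨆ q ∈ reducedAdmissible L G O m, reducedFailureProb θ q) ∧
    (⨅ q ∈ admissible L G O m, failureProb θ q)
        = (⨅ q ∈ reducedAdmissible L G O m, reducedFailureProb θ q) ∧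
    -- the reduced admissible set is described by the feasible parameters `(x₀, x₁, p, y)`
    (∀ (x₀ x₁ : ∀ k, X k) (g : ↥(cube x₀ x₁ ∪ O) → ℝ) (μ : Measure (∀ k, X k)),
      (⟨(x₀, x₁), (g, μ)⟩ : ReducedScenario O) ∈ reducedAdmissible L G O m →
        ∃ p : Fin K → unitInterval, μ = twoPointProduct x₀ x₁ p ∧
          (x₀, x₁, p, fun ε => g (cubePoint O x₀ x₁ ε)) ∈ feasible L G O m) ∧
    (∀ (x₀ x₁ : ∀ k, X k) (p : Fin K → unitInterval) (y : (Fin K → Bool) → ℝ),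
      (x₀, x₁, p, y) ∈ feasible L G O m →
        ∃! g : ↥(cube x₀ x₁ ∪ O) → ℝ,
          (⟨(x₀, x₁), (g, twoPointProduct x₀ x₁ p)⟩ : ReducedScenario O)
              ∈ reducedAdmissible L G O m ∧
            ∀ ε, g (cubePoint O x₀ x₁ ε) = y ε) ∧
    -- the dimension of the space of parameters, and of the feasible set
    ((∀ k, ∃ n : ℕ, IsLocallyParametrized (X k) n) →
      dimH (univ : Set (Parameters X))
          = 2 * ∑ k, dimH (univ : Set (X k)) + 2 ^ K + K ∧
        ((interior (feasible L G O m)).Nonempty →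
          dimH (feasible L G O m)
            = 2 * ∑ k, dimH (univ : Set (X k)) + 2 ^ K + K)) := by
  -- Second countability makes open sets of the product measurable for the product σ-algebra, hence
  -- short functions measurable, and provides the countable chart covers.
  have hsc : ∀ k, SecondCountableTopology (X k) := fun k => (hX k).secondCountableTopology
  refine ⟨iSup_failureProb_eq hL θ, iInf_failureProb_eq hL θ,
    fun x₀ x₁ g μ h => exists_parameters_of_reducedAdmissible h,
    fun x₀ x₁ p y h => existsUnique_of_feasible hG h, fun hpar => ?_⟩
  have := nonempty_parameters hpar
  exact ⟨dimH_parameters hpar (by simp), dimH_parameters hpar⟩
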